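/- Let $\mathbf T^2\subset \mathrm{SU}(3)$ be the torus of diagonal matrices, $\pi:\mathrm{SU}(3)\to Z=\mathrm{SU}(3)/\mathbf T^2$ the coset projection, and let $\gamma=U^{-1}dU$ be the left-invariant Maurer–Cartan form of $\mathrm{SU}(3)$. Put $\eta_1=\gamma_{32}$, $\eta_2=\gamma_{13}$, $\eta_3=\gamma_{21}$. The nearly Kähler structure $(g_{\mathrm{NK}},J_{\mathrm{NK}})$ on $Z$ is the one with $\pi^*g_{\mathrm{NK}}=\sum_i\operatorname{Re}(\eta_i\otimes\overline{\eta_i})$ and for which a complex 1-form $\theta$ on $Z$ is of type $(1,0)$ if and only if $\pi^*\theta$ lies in the span of $\eta_1,\eta_2,\eta_3$. Let $f:\Sigma\to Z$ be a $J_{\mathrm{NK}}$-holomorphic curve, i.e. a smooth immersion of a Riemann surface $\Sigma$ (real dimension two) whose differential intertwines the complex structure of $\Sigma$ with $J_{\mathrm{NK}}$. Give $\Sigma$ the Hermitian metric induced by $g_{\mathrm{NK}}$, let $\mathcal B(\Sigma)\to\Sigma$ be the $\mathrm U(1)$-bundle of unitary coframes, with tautological 1-form $\sigma$, and let $\mathcal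 F(\Sigma)=\mathcal B(\Sigma)\times_\Sigma f^*\mathrm{SU}(3)$, where $f^*\mathrm{SU}(3)$ is the pullback of the bundle $\pi$. Then there are unique functions $A_1,A_2,A_3:\mathcal F(\Sigma)\to\mathbb C$ with $\eta_i=A_i\,\sigma$ on $\mathcal F(\Sigma)$ for $i=1,2,3$, and the cubic form $A_1A_2A_3\,\sigma^3$ descends to $\Sigma$: there is a unique holomorphic section $C$ of the holomorphic line bundle $\mathrm{Sym}^3(T^*\Sigma)$ whose pullback to $\mathcal F(\Sigma)$ is $A_1A_2A_3\,\sigma^3$. -/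

import Mathlib

open scoped Manifold ContDiff ComplexConjugate

set_option maxSynthPendingDepth 3

noncomputable section

namespace FlagCubic

/-! ### The flag manifold `SU(3)/T²` -/

/-- The group `SU(3)`.  A point `U` is viewed as the special unitary frame
`(e₁, e₂, e₃)` of `ℂ³` formed by its columns. -/
abbrev SU3 : Type := Matrix.specialUnitaryGroup (Fin 3) ℂ

theorem SU3.conjTranspose_mul_self (U : SU3) : (U.1).conjTranspose * U.1 = 1 :=
  (Matrix.mem_unitaryGroup_iff').1 (Matrix.mem_specialUnitaryGroup_iff.1 U.2).1

/-- The maximal torus `T² ⊂ SU(3)` of diagonal matrices. -/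
def torus : Subgroup SU3 where
  carrier := {U | (U.1).IsDiag}
  one_mem' := by
    intro i j hij
    exact Matrix.one_apply_ne hij
  mul_mem' := by
    intro a b ha hb i j hij
    change (a.1 * b.1) i j = 0
    rw [Matrix.mul_apply]
    refine Finset.sum_eq_zero fun k _ => ?_
    by_cases h : i = k
    · subst h
      rw [hb hij, mul_zero]
    · rw [ha h, zero_mul]
  inv_mem' := by
    intro a ha i j hij
    change (star a.1) i j = 0
    rw [Matrix.star_apply, ha (Ne.symm hij), star_zero]

/-- The flag manifold `Z = SU(3)/T²`. -/
abbrev Flag : Type := SU3 ⧸ torus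

/-- The coset projection `π : SU(3) → SU(3)/T²`. -/
def proj (U : SU3) : Flag := QuotientGroup.mk U

/-- Two frames lie over the same flag iff they differ by phases `t₁, t₂, t₃` on the columns. -/
theorem exists_phases {U V : SU3} (h : QuotientGroup.leftRel torus U V) :
    ∃ t : Fin 3 → ℂ, (∀ k, t k * conj (t k) = 1) ∧ ∀ a k, V.1 a k = U.1 a k * t k := by
  rw [QuotientGroup.leftRel_apply] at h
  set W : SU3 := U⁻¹ * V with hW
  have hd : (W.1).IsDiag := h
  have hV : V.1 = U.1 * W.1 := by
    have : V = U * W := by rw [hW]; group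
    rw [this]; rfl
  refine ⟨fun k => W.1 k k, fun k => ?_, fun a k => ?_⟩
  · have h1 := congrFun (congrFun (SU3.conjTranspose_mul_self W) k) k
    rw [Matrix.mul_apply, Finset.sum_eq_single k] at h1
    · rw [Matrix.one_apply_eq, Matrix.conjTranspose_apply] at h1
      rw [mul_comm]; exact h1
    · intro b _ hb
      rw [hd hb, mul_zero]
    · simp
  · rw [hV, Matrix.mul_apply, Finset.sum_eq_single k]
    · intro b _ hb
      rw [hd hb, mul_zero]
    · simp

/-- For `k = 0, 1, 2` the map sending the flag `[e₁, e₂, e₃]` to the line `span e_{k+1}`, a point of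
`ℂℙ²` (the maps `τ₁, τ₂, τ₃`), where a line in `ℂ³` is represented by the orthogonal projection
`e e*` onto it.  Together the three maps are the standard smooth embedding of the homogeneous space
`SU(3)/T²` as the orbit, under conjugation, of the triple of diagonal rank one projections.  It is
used below to describe smooth maps into `SU(3)/T²` and its tangent vectors. -/
def line (k : Fin 3) (z : Flag) : Matrix (Fin 3) (Fin 3) ℂ :=
  Quotient.liftOn' z (fun U : SU3 => Matrix.of fun a b => U.1 a k * conj (U.1 b k)) (by
    intro U V h
    obtain ⟨t, ht, hV⟩ := exists_phases h
    ext a b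
    simp only [Matrix.of_apply, hV, map_mul]
    linear_combination (-(U.1 a k * conj (U.1 b k))) * ht k)

/-! ### The left-invariant forms `η₁, η₂, η₃` and the nearly Kähler structure

Indices are shifted by one: `η 0, η 1, η 2` are `η₁, η₂, η₃`. -/

/-- The forms `η_i` on `SU(3)`: for `W ∈ T_U SU(3)`, the Maurer-Cartan form is `γ(W) = U* W`, and
`η₁ = γ₃₂`, `η₂ = γ₁₃`, `η₃ = γ₂₁`. -/
def mcEta (i : Fin 3) (U : SU3) (W : Matrix (Fin 3) (Fin 3) ℂ) : ℂ :=
  ((U.1).conjTranspose * W) (i + 2) (i + 1)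

/-- The trace-free skew-Hermitian matrix with zero diagonal on which `η₁, η₂, η₃` take the
values `c 0, c 1, c 2`. -/
def mcMatrix (c : Fin 3 → ℂ) : Matrix (Fin 3) (Fin 3) ℂ :=
  !![0, -conj (c 2), c 1;
     c 2, 0, -conj (c 0);
     -conj (c 1), c 0, 0]

/-- A triple of matrices, the ambient space of the embedding of `SU(3)/T²` by the maps `line`. -/
abbrev Triple : Type := Fin 3 → Matrix (Fin 3) (Fin 3) ℂ

/-- The tangent vector of `SU(3)/T²` at `π(U)` which is the image under `dπ` of the tangent vector
`U γ` of `SU(3)` at `U`, for the matrix `γ` with `η`-components `c` and zero diagonal: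
its `k`-th component, the derivative of `line k`, is `U [γ, E_kk] U*`. -/
def tangentOf (U : SU3) (c : Fin 3 → ℂ) : Triple := fun k =>
  U.1 * (mcMatrix c * Matrix.single k k 1 - Matrix.single k k 1 * mcMatrix c) *
    (U.1).conjTranspose

/-- The forms `η_i` at the frame `U` are semibasic for `π : SU(3) → SU(3)/T²`.  For a tangent vector
`X` of `SU(3)/T²` at `π(U)`, `eta i U X` is the value of `η_i` on any tangent vector of `SU(3)` at
`U` that projects to `X`. -/
def eta (i : Fin 3) (U : SU3) (X : Triple) : ℂ :=
  ((U.1).conjTranspose * X (i + 1) * U.1) (i + 2) (i + 1)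

/-- The `η`-components of `tangentOf U c` are `c`. -/
theorem eta_tangentOf (i : Fin 3) (U : SU3) (c : Fin 3 → ℂ) :
    eta i U (tangentOf U c) = c i := by
  have h := SU3.conjTranspose_mul_self U
  have : (U.1).conjTranspose * tangentOf U c (i + 1) * U.1 =
      mcMatrix c * Matrix.single (i + 1) (i + 1) 1 -
        Matrix.single (i + 1) (i + 1) 1 * mcMatrix c := by
    unfold tangentOf
    calc _ = ((U.1).conjTranspose * U.1) * (mcMatrix c * Matrix.single (i + 1) (i + 1) 1 -
          Matrix.single (i + 1) (i + 1) 1 * mcMatrix c) * ((U.1).conjTranspose * U.1) := by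
            simp only [Matrix.mul_assoc]
      _ = _ := by rw [h, Matrix.one_mul, Matrix.mul_one]
  unfold eta
  rw [this]
  rw [Matrix.sub_apply, Matrix.mul_apply, Matrix.mul_apply]
  fin_cases i <;> simp [mcMatrix, Matrix.single_apply]

/-- If `X` is the velocity of `π ∘ U` for a curve `U` in `SU(3)` (seen through the maps `line`), then
`eta i` evaluates on `X` to the value of the Maurer-Cartan component `η_i` on the velocity of `U`. -/
theorem eta_eq_mcEta (U : ℝ → SU3) (W : Matrix (Fin 3) (Fin 3) ℂ) (X : Triple) (s : ℝ)
    (hU : ∀ a b, HasDerivAt (fun r => (U r).1 a b) (W a b) s)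
    (hX : ∀ k a b, HasDerivAt (fun r => line k (proj (U r)) a b) (X k a b) s) (i : Fin 3) :
    eta i (U s) X = mcEta i (U s) W := by
  have key : ∀ k a b, X k a b =
      W a k * conj ((U s).1 b k) + (U s).1 a k * conj (W b k) := by
    intro k a b
    exact (hX k a b).unique ((hU a k).mul (hU b k).star)
  have h := SU3.conjTranspose_mul_self (U s)
  have h1 : ∀ j k, ∑ a, conj ((U s).1 a j) * (U s).1 a k = if j = k then 1 else 0 := by
    intro j k
    have := congrFun (congrFun h j) k
    rwa [Matrix.mul_apply, Matrix.one_apply] at this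
  have a1 := h1 (i + 2) (i + 1)
  have a2 := h1 (i + 1) (i + 1)
  rw [if_neg (by fin_cases i <;> decide)] at a1
  rw [if_pos rfl] at a2
  simp only [Fin.sum_univ_three] at a1 a2
  simp only [eta, mcEta, Matrix.mul_apply, Matrix.conjTranspose_apply, key, Fin.sum_univ_three,
    RCLike.star_def]
  generalize i + 2 = m at *
  generalize i + 1 = n at *
  linear_combination
    (conj ((U s).1 0 m) * W 0 n + conj ((U s).1 1 m) * W 1 n + conj ((U s).1 2 m) * W 2 n) * a2 +
    (conj (W 0 n) * (U s).1 0 n + conj (W 1 n) * (U s).1 1 n + conj (W 2 n) * (U s).1 2 n) * a1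

/-- The velocity `X` of `π ∘ U` (seen through the maps `line`) is the tangent vector with the
components `ηᵢ(X)`; in particular tangent vectors of `SU(3)/T²` are determined by them. -/
theorem eq_tangentOf (U : ℝ → SU3) (W : Matrix (Fin 3) (Fin 3) ℂ) (X : Triple) (s : ℝ)
    (hU : ∀ a b, HasDerivAt (fun r => (U r).1 a b) (W a b) s)
    (hX : ∀ k a b, HasDerivAt (fun r => line k (proj (U r)) a b) (X k a b) s) :
    X = tangentOf (U s) fun i => eta i (U s) X := by
  have he : ∀ i, eta i (U s) X = mcEta i (U s) W := eta_eq_mcEta U W X s hU hX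
  have key : ∀ k a b, X k a b =
      W a k * conj ((U s).1 b k) + (U s).1 a k * conj (W b k) := by
    intro k a b
    exact (hX k a b).unique ((hU a k).mul (hU b k).star)
  have h := SU3.conjTranspose_mul_self (U s)
  have h' : (U s).1 * ((U s).1).conjTranspose = 1 := mul_eq_one_comm.1 h
  set G := ((U s).1).conjTranspose * W with hG
  have hW : W = (U s).1 * G := by rw [hG, ← Matrix.mul_assoc, h', Matrix.one_mul]
  have hsk : ∀ j k, conj (G k j) = - G j k := by
    intro j k
    have d : HasDerivAt (fun r => ∑ a, conj ((U r).1 a j) * (U r).1 a k)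
        (∑ a, (conj (W a j) * (U s).1 a k + conj ((U s).1 a j) * W a k)) s :=
      HasDerivAt.fun_sum fun a _ => (hU a j).star.mul (hU a k)
    have c : (fun r => ∑ a, conj ((U r).1 a j) * (U r).1 a k) =
        fun _ => (1 : Matrix (Fin 3) (Fin 3) ℂ) j k := by
      funext r
      rw [← SU3.conjTranspose_mul_self (U r)]
      rfl
    rw [c] at d
    have z := d.unique (hasDerivAt_const s _)
    simp only [hG, Matrix.mul_apply, Matrix.conjTranspose_apply, Fin.sum_univ_three, map_add,
      map_mul, RCLike.star_def, Complex.conj_conj] at z ⊢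
    linear_combination z
  funext k
  have hXk : X k = (U s).1 * (G * Matrix.single k k 1 - Matrix.single k k 1 * G) *
      ((U s).1).conjTranspose := by
    have hGs : G.conjTranspose = -G := by
      ext a b
      exact hsk a b
    have e : X k = W * Matrix.single k k 1 * ((U s).1).conjTranspose +
        (U s).1 * Matrix.single k k 1 * W.conjTranspose := by
      ext a b
      rw [key, Matrix.add_apply]
      fin_cases k <;> simp [Matrix.mul_apply, Fin.sum_univ_three, Matrix.single_apply]
    rw [e, hW, Matrix.conjTranspose_mul, hGs]
    noncomm_ring
  rw [hXk]
  unfold tangentOf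
  congr 2
  have hc : ∀ i, eta i (U s) X = G (i + 2) (i + 1) := he
  simp only [hc]
  have s1 := hsk 0 1
  have s2 := hsk 2 0
  have s3 := hsk 1 2
  have hM : ∀ a b, a ≠ b → G a b = mcMatrix (fun i => G (i + 2) (i + 1)) a b := by
    intro a b hab
    fin_cases a <;> fin_cases b <;> simp [mcMatrix, s1, s2, s3] at hab ⊢
  generalize mcMatrix (fun i => G (i + 2) (i + 1)) = M at hM
  ext a b
  have r : ∀ A : Matrix (Fin 3) (Fin 3) ℂ,
      (A * Matrix.single k k (1 : ℂ) - Matrix.single k k (1 : ℂ) * A : Matrix (Fin 3) (Fin 3) ℂ) a b =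
        (if k = b then A a k else 0) - (if k = a then A k b else 0) := by
    intro A
    rw [Matrix.sub_apply, Matrix.mul_apply, Matrix.mul_apply]
    simp [Matrix.single_apply, ite_and]
  rw [r, r]
  by_cases hb : k = b <;> by_cases ha : k = a
  · subst hb; subst ha; simp
  · subst hb; simp [ha, hM a k (Ne.symm ha)]
  · subst ha; simp [hb, hM k b hb]
  · simp [ha, hb]

theorem eta_phases {U V : SU3} {t : Fin 3 → ℂ} (hV : ∀ a k, V.1 a k = U.1 a k * t k)
    (i : Fin 3) (X : Triple) :
    eta i V X = conj (t (i + 2)) * t (i + 1) * eta i U X := by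
  simp only [eta, Matrix.mul_apply, Matrix.conjTranspose_apply, hV, Fin.sum_univ_three,
    RCLike.star_def, map_mul]
  ring

/-- The nearly Kähler metric of `SU(3)/T²`: `g_NK = Re ∑ᵢ ηᵢ ⊗ conj ηᵢ`, computed in any adapted
frame. -/
def gNK (z : Flag) (X Y : Triple) : ℝ :=
  Quotient.liftOn' z (fun U : SU3 => (∑ i, eta i U X * conj (eta i U Y)).re) (by
    intro U V h
    obtain ⟨t, ht, hV⟩ := exists_phases h
    refine congrArg Complex.re (Finset.sum_congr rfl fun i _ => ?_)
    rw [eta_phases hV, eta_phases hV]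
    simp only [map_mul, Complex.conj_conj]
    linear_combination (-(eta i U X * conj (eta i U Y))) * (ht (i + 2)) +
      (-(eta i U X * conj (eta i U Y)) * (t (i + 2) * conj (t (i + 2)))) * (ht (i + 1)))

/-- The nearly Kähler almost complex structure of `SU(3)/T²`, for which `η₁, η₂, η₃` are the forms
of type `(1,0)`: `J_NK X` is the tangent vector with `ηᵢ(J_NK X) = i ηᵢ(X)`, in any adapted frame. -/
def JNK (z : Flag) (X : Triple) : Triple :=
  Quotient.liftOn' z (fun U : SU3 => tangentOf U fun i => Complex.I * eta i U X) (by
    intro U V h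
    obtain ⟨t, ht, hV⟩ := exists_phases h
    have hm : mcMatrix (fun i => Complex.I * eta i V X) =
        Matrix.diagonal (fun k => conj (t k)) * mcMatrix (fun i => Complex.I * eta i U X) *
          Matrix.diagonal t := by
      simp only [eta_phases hV]
      ext a b
      rw [Matrix.mul_diagonal, Matrix.diagonal_mul]
      fin_cases a <;> fin_cases b <;> simp [mcMatrix] <;> ring
    have hVm : V.1 = U.1 * Matrix.diagonal t := by
      ext a k
      rw [Matrix.mul_diagonal, hV]
    have hVs : (V.1).conjTranspose =
        Matrix.diagonal (fun k => conj (t k)) * (U.1).conjTranspose := by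
      rw [hVm, Matrix.conjTranspose_mul, Matrix.diagonal_conjTranspose]
      rfl
    have htt : Matrix.diagonal t * Matrix.diagonal (fun k => conj (t k)) = 1 := by
      rw [Matrix.diagonal_mul_diagonal]
      simp only [ht, Matrix.diagonal_one]
    funext k
    have hc : Matrix.diagonal t * Matrix.single k k (1 : ℂ) =
        Matrix.single k k 1 * Matrix.diagonal t := by
      ext a b
      rw [Matrix.mul_diagonal, Matrix.diagonal_mul]
      by_cases h : k = a ∧ k = b
      · obtain ⟨rfl, rfl⟩ := h
        rw [mul_comm]
      · rw [Matrix.single_apply, if_neg h, mul_zero, zero_mul]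
    have hc' : Matrix.single k k (1 : ℂ) * Matrix.diagonal (fun k => conj (t k)) =
        Matrix.diagonal (fun k => conj (t k)) * Matrix.single k k 1 := by
      ext a b
      rw [Matrix.mul_diagonal, Matrix.diagonal_mul]
      by_cases h : k = a ∧ k = b
      · obtain ⟨rfl, rfl⟩ := h
        rw [mul_comm]
      · rw [Matrix.single_apply, if_neg h, mul_zero, zero_mul]
    unfold tangentOf
    rw [hm, hVs, hVm]
    set D := Matrix.diagonal t
    set D' := Matrix.diagonal (fun k => conj (t k))
    set M := mcMatrix (fun i => Complex.I * eta i U X)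
    set E : Matrix (Fin 3) (Fin 3) ℂ := Matrix.single k k 1
    have e1 : D * (D' * M * D * E - E * (D' * M * D)) * D' = M * E - E * M := by
      have f1 : D * (D' * M * D * E) * D' = M * E := by
        calc _ = (D * D') * M * (D * E) * D' := by simp only [Matrix.mul_assoc]
          _ = M * E * (D * D') := by rw [hc, htt, Matrix.one_mul]; simp only [Matrix.mul_assoc, htt]
          _ = _ := by rw [htt, Matrix.mul_one]
      have f2 : D * (E * (D' * M * D)) * D' = E * M := by
        calc _ = D * (E * D') * M * (D * D') := by simp only [Matrix.mul_assoc]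
          _ = (D * D') * E * M := by
            rw [hc', htt, Matrix.mul_one, ← Matrix.mul_assoc D D' E, htt]
          _ = _ := by rw [htt, Matrix.one_mul]
      rw [mul_sub, sub_mul, f1, f2]
    rw [← e1]
    simp only [Matrix.mul_assoc])

theorem eta_JNK (i : Fin 3) (U : SU3) (X : Triple) :
    eta i U (JNK (proj U) X) = Complex.I * eta i U X :=
  eta_tangentOf i U _

/-! ### Pseudoholomorphic curves -/

section Curves

variable {S : Type*} [TopologicalSpace S] [ChartedSpace ℂ S]

/-- The differential `df_p : T_p S → T_{f(p)} (SU(3)/T²)` of a map from a Riemann surface into the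
flag manifold, seen through the embedding `line`.  The real tangent space of `S` at `p` is identified
with the complex line `T_p S`, multiplication by `i` being the complex structure of `S`. -/
def flagDeriv (f : S → Flag) (p : S) (v : TangentSpace 𝓘(ℂ) p) : Triple := fun k =>
  Matrix.of fun a b =>
    (mfderiv 𝓘(ℝ, ℂ) 𝓘(ℝ, ℂ) (fun x => line k (f x) a b) p : ℂ →L[ℝ] ℂ) v

/-- `f : S → SU(3)/T²` is a `J_NK`-holomorphic curve: a smooth immersion of a Riemann surface with
complex linear differential, `df ∘ i = J_NK ∘ df`. -/
structure IsJHolomorphicCurve (f : S → Flag) : Prop where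
  smooth : ∀ k a b, ContMDiff 𝓘(ℝ, ℂ) 𝓘(ℝ, ℂ) ∞ fun x => line k (f x) a b
  immersion : ∀ p, Function.Injective (flagDeriv f p)
  holomorphic : ∀ (p : S) (v : TangentSpace 𝓘(ℂ) p),
    flagDeriv f p (Complex.I • v) = JNK (f p) (flagDeriv f p v)

/-- A point of `𝓕(S) = 𝓑(S) ×_S f^* SU(3)`: a point `p` of `S`, a coframe `σ` at `p` (a complex
linear form on `T_p S`) that is unitary for the Hermitian metric on `S` induced by `g_NK`, and a frame
in `SU(3)` adapted to the flag `f(p)`. -/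
structure FramePoint (f : S → Flag) where
  pt : S
  σ : TangentSpace 𝓘(ℂ) pt →L[ℂ] ℂ
  unitary : ∀ v : TangentSpace 𝓘(ℂ) pt, ‖σ v‖ ^ 2 = gNK (f pt) (flagDeriv f pt v) (flagDeriv f pt v)
  frame : SU3
  adapted : proj frame = f pt

/-- The functions `A = (A₁, A₂, A₃)` on `𝓕(S)` satisfy `ηᵢ = Aᵢ σ`.  Both the pullback of `ηᵢ` to
`𝓕(S)` and the tautological form `σ` are semibasic over `S`, so at each point of `𝓕(S)` the identity
is one between linear forms on the tangent space of `S`. -/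
def IsCoefficients (f : S → Flag) (A : Fin 3 → FramePoint f → ℂ) : Prop :=
  ∀ (i : Fin 3) (q : FramePoint f) (v : TangentSpace 𝓘(ℂ) q.pt),
    eta i q.frame (flagDeriv f q.pt v) = A i q * q.σ v

/-- The fibre at `p` of `Sym³(T^*S)`: complex trilinear forms on the complex line `T_p S`.  Since
`T_p S` is one-dimensional all of them are symmetric, see `CubicForm.symm₁₂` and
`CubicForm.symm₂₃`. -/
abbrev CubicForm (p : S) : Type :=
  TangentSpace 𝓘(ℂ) p →L[ℂ] TangentSpace 𝓘(ℂ) p →L[ℂ] TangentSpace 𝓘(ℂ) p →L[ℂ] ℂ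

theorem CubicForm.symm₁₂ {p : S} (C : CubicForm p) (u v w : TangentSpace 𝓘(ℂ) p) :
    C u v w = C v u w := by
  have h : ∀ B : ℂ →L[ℂ] ℂ →L[ℂ] ℂ →L[ℂ] ℂ, ∀ a b c : ℂ, B a b c = B b a c := by
    intro B a b c
    have e : ∀ a b, B a b c = a * (b * B 1 1 c) := by
      intro a b
      have h1 : B a = a • B 1 := by rw [← map_smul, smul_eq_mul, mul_one]
      have h2 : B 1 b = b • B 1 1 := by rw [← map_smul, smul_eq_mul, mul_one]
      rw [h1, smul_apply, h2]
      rfl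
    rw [e a b, e b a]
    ring
  exact h C u v w

theorem CubicForm.symm₂₃ {p : S} (C : CubicForm p) (u v w : TangentSpace 𝓘(ℂ) p) :
    C u v w = C u w v := by
  have h : ∀ B : ℂ →L[ℂ] ℂ →L[ℂ] ℂ, ∀ b c : ℂ, B b c = B c b := by
    intro B b c
    have e : ∀ b c, B b c = b * (c * B 1 1) := by
      intro b c
      have h1 : B b = b • B 1 := by rw [← map_smul, smul_eq_mul, mul_one]
      have h2 : B 1 c = c • B 1 1 := by rw [← map_smul, smul_eq_mul, mul_one]
      rw [h1, smul_apply, h2]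
      rfl
    rw [e b c, e c b]
    ring
  exact h (C u) v w

/-- The cube `σ³`, `(u, v, w) ↦ σ(u) σ(v) σ(w)`, of a cotangent vector. -/
def cube {p : S} (σ : TangentSpace 𝓘(ℂ) p →L[ℂ] ℂ) : CubicForm p :=
  σ.smulRight (σ.smulRight σ)

theorem cube_apply {p : S} (σ : TangentSpace 𝓘(ℂ) p →L[ℂ] ℂ) (u v w : TangentSpace 𝓘(ℂ) p) :
    cube σ u v w = σ u * (σ v * σ w) := rfl

/-- Holomorphic sections of `Sym³(T^*S)`: complex analytic sections of the bundle of cubic forms with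
the vector bundle structure induced by that of the tangent bundle `TS`. -/
abbrev HolomorphicCubicForm (S : Type*) [TopologicalSpace S] [ChartedSpace ℂ S]
    [IsManifold 𝓘(ℂ) ω S] : Type _ :=
  ContMDiffSection 𝓘(ℂ) (ℂ →L[ℂ] ℂ →L[ℂ] ℂ →L[ℂ] ℂ) ω (fun p : S => CubicForm p)

end Curves

end FlagCubic

end

/-! Up to torus connection terms, the structure equations read `dη₁ ≡ conj η₂ ∧ conj η₃`, and
cyclically. Along a `J_NK`-holomorphic curve every `ηᵢ` has type (1,0), so the right-hand side is a
product of two (0,1)-forms on a complex curve and vanishes. Each `ηᵢ` is thus holomorphic for a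
connection on a line bundle, and the three torus weights cancel in `η₁η₂η₃`, leaving a holomorphic
cubic form on the curve.

The argument runs without local frames. With `P k` the orthogonal projection onto the `k`-th line of
the flag, the corner `P (i+1) * dP i * P i` carries one of the forms `ηⱼ`, and the trace of the
cyclic product of the three corners is `η₁η₂η₃` (`cubicTrace_line`). Holomorphy of the curve makes
these corners complex linear and their adjoints antilinear. `corner_eq_zero` is the structure
equation in this language: the `∂̄`-derivative of a corner has no component in that same corner. In
`differentiableOn_trace_corners` the trace sees only this component, so Cauchy–Riemann holds.

The rest transfers the result to the surface: `exists_differentiableOn_cubicCoeff` applies it in a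
fixed chart, and `trivializationAt_cubicForm_apply` identifies the chart coefficient with the one in
the bundle trivialization. Existence and uniqueness of the `Aᵢ` are linear algebra on a complex line
with `σ ≠ 0`. -/

noncomputable section

namespace FlagCubic

/-! ### Wirtinger operators -/

section Wirtinger

variable {E : Type*} [NormedAddCommGroup E] [NormedSpace ℂ E]

/-- The operator `∂_x + s ∂_y` on functions of `z = x + i y`: twice the Wirtinger derivative `∂` for
`s = -i`, and twice `∂̄` for `s = i`. -/
def wirtinger (s : ℂ) (F : ℂ → E) (z : ℂ) : E :=
  fderiv ℝ F z 1 + s • fderiv ℝ F z Complex.I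

theorem wirtinger_congr {s : ℂ} {F G : ℂ → E} {U : Set ℂ} (hU : IsOpen U) (h : Set.EqOn F G U)
    {z : ℂ} (hz : z ∈ U) : wirtinger s F z = wirtinger s G z := by
  have : F =ᶠ[nhds z] G := h.eventuallyEq_of_mem (hU.mem_nhds hz)
  rw [wirtinger, wirtinger, this.fderiv_eq]

theorem wirtinger_const (s : ℂ) (x : E) (z : ℂ) : wirtinger s (fun _ => x) z = 0 := by
  simp [wirtinger]

theorem wirtinger_clm_comp {E' : Type*} [NormedAddCommGroup E'] [NormedSpace ℂ E'] {s : ℂ}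
    (L : E →L[ℂ] E') {F : ℂ → E} {z : ℂ} (hF : DifferentiableAt ℝ F z) :
    wirtinger s (fun w => L (F w)) z = L (wirtinger s F z) := by
  have h : fderiv ℝ (fun w => L (F w)) z = (L.restrictScalars ℝ).comp (fderiv ℝ F z) :=
    ((L.restrictScalars ℝ).hasFDerivAt.comp z hF.hasFDerivAt).fderiv
  simp [wirtinger, h]

theorem wirtinger_mul {A : Type*} [NormedRing A] [NormedAlgebra ℂ A] {s : ℂ} {F G : ℂ → A} {z : ℂ}
    (hF : DifferentiableAt ℝ F z) (hG : DifferentiableAt ℝ G z) :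
    wirtinger s (fun w => F w * G w) z = wirtinger s F z * G z + F z * wirtinger s G z := by
  simp only [wirtinger, fderiv_fun_mul' hF hG, add_apply, smul_apply, smul_add,
    MulOpposite.smul_eq_mul_unop, MulOpposite.unop_op, smul_eq_mul, add_mul, mul_add,
    mul_smul_comm, smul_mul_assoc]
  abel

theorem contDiffOn_wirtinger {s : ℂ} {F : ℂ → E} {U : Set ℂ} (hU : IsOpen U)
    (hF : ContDiffOn ℝ ∞ F U) : ContDiffOn ℝ ∞ (wirtinger s F) U := by
  have h : ContDiffOn ℝ ∞ (fderiv ℝ F) U := hF.fderiv_of_isOpen hU (by simp)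
  have h1 : ∀ v : ℂ, ContDiffOn ℝ ∞ (fun z => fderiv ℝ F z v) U := fun v =>
    h.clm_apply contDiffOn_const
  exact (h1 1).add ((h1 Complex.I).const_smul s)

/-- Both operators have constant coefficients, so this is the symmetry of the second real
derivative. It lets a type condition, once differentiated by `∂`, speak about a `∂̄`-derivative. -/
theorem wirtinger_comm (s t : ℂ) {F : ℂ → E} {U : Set ℂ} (hU : IsOpen U)
    (hF : ContDiffOn ℝ ∞ F U) {z : ℂ} (hz : z ∈ U) :
    wirtinger s (wirtinger t F) z = wirtinger t (wirtinger s F) z := by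
  have h : DifferentiableAt ℝ (fderiv ℝ F) z :=
    ((hF.fderiv_of_isOpen (m := ∞) hU (by simp)).differentiableOn (by simp)).differentiableAt
      (hU.mem_nhds hz)
  have hs : IsSymmSndFDerivAt ℝ F z :=
    (hF.contDiffAt (hU.mem_nhds hz)).isSymmSndFDerivAt (by
      simpa using WithTop.coe_le_coe.2 (le_top : (2 : ℕ∞) ≤ ⊤))
  have e : ∀ v : ℂ, HasFDerivAt (fun w => fderiv ℝ F w v) ((fderiv ℝ (fderiv ℝ F) z).flip v) z :=
    fun v => by
      simpa using h.hasFDerivAt.clm_apply (hasFDerivAt_const v z)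
  have key : ∀ t : ℂ, fderiv ℝ (wirtinger t F) z = (fderiv ℝ (fderiv ℝ F) z).flip 1 +
      t • (fderiv ℝ (fderiv ℝ F) z).flip Complex.I := fun t =>
    ((e 1).add ((e Complex.I).const_smul t)).fderiv
  simp only [wirtinger.eq_1 s (wirtinger t F), wirtinger.eq_1 t (wirtinger s F), key, add_apply,
    smul_apply, ContinuousLinearMap.flip_apply, hs.eq Complex.I 1, smul_add, smul_smul, mul_comm s t]
  abel

theorem differentiableAt_complex_of_wirtinger_eq_zero {F : ℂ → E} {z : ℂ}
    (hF : DifferentiableAt ℝ F z) (h : wirtinger Complex.I F z = 0) : DifferentiableAt ℂ F z := by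
  rw [differentiableAt_complex_iff_differentiableAt_real]
  refine ⟨hF, ?_⟩
  have h1 : fderiv ℝ F z 1 = -(Complex.I • fderiv ℝ F z Complex.I) := eq_neg_of_add_eq_zero_left h
  rw [h1, smul_neg, smul_smul, Complex.I_mul_I, neg_one_smul, neg_neg]

end Wirtinger

/-! ### Resolutions of the identity by three projections -/

section Projections

/-- The mixed derivative identity behind the structure equation `dη₁ ≡ conj η₂ ∧ conj η₃`: `R`, `T`,
`O` are projections with first order derivatives `p`, `q` and mixed derivative `r` of `R`. -/
theorem corner_eq_zero {A : Type*} [Ring A] {R T O pR pT pO qR qT qO r : A}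
    (hR : R * R = R) (hT : T * T = T) (hsum : O + R + T = 1) (hTR : T * R = 0)
    (pRO : pR * O + R * pO = 0) (pOR : pO * R + O * pR = 0) (hO : O * O = O)
    (qRR : qR * R + R * qR = qR) (qTT : qT * T + T * qT = qT)
    (qTR : qT * R + T * qR = 0) (qRT : qR * T + R * qT = 0) (qRO : qR * O + R * qO = 0)
    (jR : T * qR * R = 0) (jT : T * pT * O = 0) (jO : O * pO * R = 0)
    (hr : (pT * qR + T * r) * R + T * qR * pR = 0) :
    T * ((qT * pR + T * r) * R + T * pR * qR) * R = 0 := by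
  -- Every product below is split by inserting `1 = O + R + T`; orthogonality and the type
  -- conditions kill most blocks.
  have one : ∀ x y : A, x * y = x * O * y + x * R * y + x * T * y := fun x y => by
    rw [← add_mul, ← add_mul, ← mul_add, ← mul_add, hsum, mul_one]
  have RqR : R * qR * R = 0 := by
    have := congrArg (fun x => R * x * R) qRR
    simp only [mul_add, add_mul, mul_assoc, hR] at this
    rw [← mul_assoc R R, hR] at this
    simpa [mul_assoc] using this
  have TqT : T * qT * T = 0 := by
    have := congrArg (fun x => T * x * T) qTT
    simp only [mul_add, add_mul, mul_assoc, hT] at this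
    rw [← mul_assoc T T, hT] at this
    simpa [mul_assoc] using this
  have TqTR : T * qT * R = 0 := by
    have h : qT * R = -(T * qR) := eq_neg_of_add_eq_zero_left qTR
    calc T * qT * R = T * (qT * R) * R := by rw [mul_assoc, mul_assoc, mul_assoc, hR]
      _ = -(T * T * qR * R) := by rw [h]; noncomm_ring
      _ = 0 := by rw [hT, jR, neg_zero]
  have OpR : O * pR * R = 0 := by
    have h : O * pR = -(pO * R) := eq_neg_of_add_eq_zero_right pOR
    calc O * pR * R = O * (O * pR) * R := by rw [← mul_assoc O O, hO]
      _ = -(O * pO * (R * R)) := by rw [h]; noncomm_ring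
      _ = 0 := by rw [hR, jO, neg_zero]
  have TpRO : T * pR * O = 0 := by
    have h : pR * O = -(R * pO) := eq_neg_of_add_eq_zero_left pRO
    rw [mul_assoc, h, mul_neg, ← mul_assoc, hTR, zero_mul, neg_zero]
  have TqRT : T * qR * T = 0 := by
    have h : qR * T = -(R * qT) := eq_neg_of_add_eq_zero_left qRT
    rw [mul_assoc, h, mul_neg, ← mul_assoc, hTR, zero_mul, neg_zero]
  have TqRO : T * qR * O = 0 := by
    have h : qR * O = -(R * qO) := eq_neg_of_add_eq_zero_left qRO
    rw [mul_assoc, h, mul_neg, ← mul_assoc, hTR, zero_mul, neg_zero]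
  -- Two of the three blocks vanish by orthogonality alone, the third by the type condition `jR`.
  have TqR : T * qR = 0 := by
    have := one (T * qR) 1
    simpa [TqRO, jR, TqRT] using this
  -- `t1` and `t2` are the two halves of `conj η₂ ∧ conj η₃`: both products factor through `O`, and
  -- in each the factor differentiated by `p` is a corner that vanishes by type.
  have t1 : T * qT * pR * R = 0 := by
    have : T * qT * pR = T * qT * O * pR := by
      rw [one (T * qT) pR, TqTR, TqT, zero_mul, add_zero, add_zero]
    rw [this, mul_assoc _ pR, mul_assoc _ O, ← mul_assoc O, OpR, mul_zero]
  have qRR' : qR * R = O * qR * R := by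
    have := one 1 (qR * R)
    simp only [one_mul, ← mul_assoc] at this
    simpa [RqR, jR] using this
  have t2 : T * pT * qR * R = 0 := by
    rw [mul_assoc _ qR, qRR', ← mul_assoc, ← mul_assoc, jT, zero_mul, zero_mul]
  have t3 : T * pR * qR * R = 0 := by
    rw [mul_assoc _ qR, qRR', ← mul_assoc, ← mul_assoc, TpRO, zero_mul, zero_mul]
  -- The mixed derivative is controlled by differentiating `jR`, which is the content of `hr`.
  have t4 : T * T * r * R * R = 0 := by
    have e : T * ((pT * qR + T * r) * R + T * qR * pR) * R =
        T * pT * qR * R * R + T * T * r * R * R + T * (T * qR) * pR * R := by noncomm_ring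
    rw [hr, t2, TqR] at e
    simpa using e.symm
  have e : T * ((qT * pR + T * r) * R + T * pR * qR) * R =
      T * qT * pR * R * R + T * T * r * R * R + T * T * pR * qR * R := by noncomm_ring
  rw [e, t1, t4, hT, t3, zero_mul, add_zero, add_zero]

variable {A : Type*} [NormedRing A] [NormedAlgebra ℂ A]

/-- Instance of `corner_eq_zero` with `p` standing for `∂` and `q` for `∂̄`, up to factors 2. The
hypothesis `jR` says that one form `ηᵢ` has type (1,0); `jT` and `jO` say that the conjugates of the
other two have type (0,1). -/
theorem wirtinger_corner_eq_zero {U : Set ℂ} (hU : IsOpen U) {R T O : ℂ → A}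
    (sR : ContDiffOn ℝ ∞ R U) (sT : ContDiffOn ℝ ∞ T U) (sO : ContDiffOn ℝ ∞ O U)
    (hR : ∀ z ∈ U, R z * R z = R z) (hT : ∀ z ∈ U, T z * T z = T z) (hO : ∀ z ∈ U, O z * O z = O z)
    (hsum : ∀ z ∈ U, O z + R z + T z = 1) (hTR : ∀ z ∈ U, T z * R z = 0)
    (hRT : ∀ z ∈ U, R z * T z = 0) (hRO : ∀ z ∈ U, R z * O z = 0) (hOR : ∀ z ∈ U, O z * R z = 0)
    (jR : ∀ z ∈ U, T z * wirtinger Complex.I R z * R z = 0)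
    (jT : ∀ z ∈ U, T z * wirtinger (-Complex.I) T z * O z = 0)
    (jO : ∀ z ∈ U, O z * wirtinger (-Complex.I) O z * R z = 0) {z : ℂ} (hz : z ∈ U) :
    T z * wirtinger Complex.I (fun w => T w * wirtinger (-Complex.I) R w * R w) z * R z = 0 := by
  have d : ∀ {F : ℂ → A}, ContDiffOn ℝ ∞ F U → DifferentiableAt ℝ F z := fun h =>
    (h.differentiableOn (by simp)).differentiableAt (hU.mem_nhds hz)
  have m : ∀ (s : ℂ) {F G H : ℂ → A}, ContDiffOn ℝ ∞ F U → ContDiffOn ℝ ∞ G U →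
      (∀ w ∈ U, F w * G w = H w) →
      wirtinger s F z * G z + F z * wirtinger s G z = wirtinger s H z := fun s F G H hF hG h => by
    rw [← wirtinger_mul (d hF) (d hG)]
    exact wirtinger_congr hU h hz
  have m0 : ∀ (s : ℂ) {F G : ℂ → A}, ContDiffOn ℝ ∞ F U → ContDiffOn ℝ ∞ G U →
      (∀ w ∈ U, F w * G w = 0) →
      wirtinger s F z * G z + F z * wirtinger s G z = 0 := fun s F G hF hG h => by
    rw [m s hF hG h, wirtinger_const]
  have m3 : ∀ (s t : ℂ), wirtinger s (fun w => T w * wirtinger t R w * R w) z =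
      (wirtinger s T z * wirtinger t R z + T z * wirtinger s (wirtinger t R) z) * R z +
        T z * wirtinger t R z * wirtinger s R z := fun s t => by
    have h := contDiffOn_wirtinger (s := t) hU sR
    rw [wirtinger_mul (d (sT.mul h)) (d sR), wirtinger_mul (d sT) (d h)]
  rw [m3]
  refine corner_eq_zero (hR z hz) (hT z hz) (hsum z hz) (hTR z hz) (m0 _ sR sO hRO)
    (m0 _ sO sR hOR) (hO z hz) (m _ sR sR hR) (m _ sT sT hT) (m0 _ sT sR hTR) (m0 _ sR sT hRT)
    (m0 _ sR sO hRO) (jR z hz) (jT z hz) (jO z hz) ?_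
  -- After exchanging the mixed derivatives, `hr` is the `∂`-derivative of the identity `jR`, which
  -- holds on all of `U`.
  rw [wirtinger_comm _ _ hU sR hz, ← m3, wirtinger_congr hU jR hz, wirtinger_const]

/-- Let `P 0`, `P 1`, `P 2` be a smooth resolution of the identity by projections, whose derivatives
satisfy the type conditions of a `J_NK`-holomorphic curve. Then the trace of the product of the three
corners is holomorphic. -/
theorem differentiableOn_trace_corners {U : Set ℂ} (hU : IsOpen U) {P : Fin 3 → ℂ → A}
    (sP : ∀ i, ContDiffOn ℝ ∞ (P i) U) (hP : ∀ z ∈ U, ∀ i, P i z * P i z = P i z)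
    (hPP : ∀ z ∈ U, ∀ i j, i ≠ j → P i z * P j z = 0) (hsum : ∀ z ∈ U, ∑ i, P i z = 1)
    (hq : ∀ z ∈ U, ∀ i, P (i + 1) z * fderiv ℝ (P i) z Complex.I * P i z =
      Complex.I • (P (i + 1) z * fderiv ℝ (P i) z 1 * P i z))
    (hp : ∀ z ∈ U, ∀ i, P i z * fderiv ℝ (P i) z Complex.I * P (i + 1) z =
      -Complex.I • (P i z * fderiv ℝ (P i) z 1 * P (i + 1) z))
    (tr : A →L[ℂ] ℂ) (htr : ∀ x y, tr (x * y) = tr (y * x)) :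
    DifferentiableOn ℂ (fun z => tr ((P 2 z * fderiv ℝ (P 1) z 1 * P 1 z) *
      (P 1 z * fderiv ℝ (P 0) z 1 * P 0 z) * (P 0 z * fderiv ℝ (P 2) z 1 * P 2 z))) U := by
  set a : Fin 3 → ℂ → A := fun i w => P (i + 1) w * wirtinger (-Complex.I) (P i) w * P i w with ha
  have jq : ∀ i, ∀ z ∈ U, P (i + 1) z * wirtinger Complex.I (P i) z * P i z = 0 := fun i z hz => by
    simp only [wirtinger, mul_add, add_mul, mul_smul_comm, smul_mul_assoc, hq z hz i, smul_smul,
      Complex.I_mul_I, neg_one_smul, add_neg_cancel]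
  have jp : ∀ i, ∀ z ∈ U, P i z * wirtinger (-Complex.I) (P i) z * P (i + 1) z = 0 := fun i z hz => by
    simp only [wirtinger, mul_add, add_mul, mul_smul_comm, smul_mul_assoc, hp z hz i, smul_smul,
      Complex.I_mul_I, neg_one_smul, add_neg_cancel, neg_mul_neg]
  have sa : ∀ i, ContDiffOn ℝ ∞ (a i) U := fun i =>
    ((sP _).mul (contDiffOn_wirtinger hU (sP i))).mul (sP i)
  have aeq : ∀ i, ∀ z ∈ U, P (i + 1) z * fderiv ℝ (P i) z 1 * P i z = (2⁻¹ : ℂ) • a i z := by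
    intro i z hz
    simp only [ha, wirtinger, mul_add, add_mul, mul_smul_comm, smul_mul_assoc, hq z hz i, smul_smul,
      neg_mul, Complex.I_mul_I, neg_neg, one_smul]
    rw [← two_smul ℂ, smul_smul]
    norm_num
  have h0 : ∀ i : Fin 3, i + 1 ≠ i ∧ i ≠ i + 1 ∧ i + 2 ≠ i ∧ i ≠ i + 2 ∧ i + 1 + 1 = i + 2 ∧
      i + 2 + 1 = i := by decide
  have corner : ∀ i, ∀ z ∈ U, P (i + 1) z * wirtinger Complex.I (a i) z * P i z = 0 := by
    intro i z hz
    obtain ⟨h1, h2, h3, h4, h5, h6⟩ := h0 i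
    refine wirtinger_corner_eq_zero hU (sP i) (sP (i + 1)) (sP (i + 2)) (fun w hw => hP w hw _)
      (fun w hw => hP w hw _) (fun w hw => hP w hw _) (fun w hw => ?_)
      (fun w hw => hPP w hw _ _ h1) (fun w hw => hPP w hw _ _ h2) (fun w hw => hPP w hw _ _ h4)
      (fun w hw => hPP w hw _ _ h3) (jq i) (h5 ▸ jp (i + 1)) ?_ hz
    · rw [← hsum w hw, Fin.sum_univ_three]
      fin_cases i <;> simp <;> abel
    · have := jp (i + 2)
      rwa [h6] at this
  have aL : ∀ i, ∀ z ∈ U, P (i + 1) z * a i z = a i z := fun i z hz => by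
    simp only [ha, ← mul_assoc, hP z hz]
  have aR : ∀ i, ∀ z ∈ U, a i z * P i z = a i z := fun i z hz => by
    simp only [ha, mul_assoc, hP z hz]
  have hd : DifferentiableOn ℂ (fun z => tr (a 1 z * a 0 z * a 2 z)) U := by
    intro z hz
    refine DifferentiableAt.differentiableWithinAt ?_
    have d : ∀ {F : ℂ → A}, ContDiffOn ℝ ∞ F U → DifferentiableAt ℝ F z := fun h =>
      (h.differentiableOn (by simp)).differentiableAt (hU.mem_nhds hz)
    have s3 := ((sa 1).mul (sa 0)).mul (sa 2)
    refine differentiableAt_complex_of_wirtinger_eq_zero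
      ((tr.restrictScalars ℝ).differentiableAt.comp z (d s3)) ?_
    rw [wirtinger_clm_comp tr (d s3), wirtinger_mul (d ((sa 1).mul (sa 0))) (d (sa 2)),
      wirtinger_mul (d (sa 1)) (d (sa 0)), add_mul, map_add, map_add]
    have L0 := aL 0 z hz
    have L1 := aL 1 z hz
    have L2 := aL 2 z hz
    have R0 := aR 0 z hz
    have R1 := aR 1 z hz
    have R2 := aR 2 z hz
    have c0 := corner 0 z hz
    have c1 := corner 1 z hz
    have c2 := corner 2 z hz
    simp only [zero_add, show (1 : Fin 3) + 1 = 2 from rfl, show (2 : Fin 3) + 1 = 0 from rfl]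
      at L0 L1 L2 c0 c1 c2
    set w0 := wirtinger Complex.I (a 0) z
    set w1 := wirtinger Complex.I (a 1) z
    set w2 := wirtinger Complex.I (a 2) z
    -- The undifferentiated factors absorb projections on their outer sides; cyclicity of the trace
    -- then encloses the differentiated factor in its own corner.
    have e1 : tr (w1 * a 0 z * a 2 z) = 0 := by
      calc tr (w1 * a 0 z * a 2 z) = tr (w1 * (P 1 z * a 0 z) * (a 2 z * P 2 z)) := by rw [L0, R2]
        _ = tr ((w1 * P 1 z * a 0 z * a 2 z) * P 2 z) := by simp only [mul_assoc]
        _ = tr ((P 2 z * w1 * P 1 z) * a 0 z * a 2 z) := by rw [htr]; simp only [mul_assoc]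
        _ = 0 := by rw [c1, zero_mul, zero_mul, map_zero]
    have e2 : tr (a 1 z * w0 * a 2 z) = 0 := by
      calc tr (a 1 z * w0 * a 2 z) = tr ((a 1 z * P 1 z) * w0 * (P 0 z * a 2 z)) := by rw [L2, R1]
        _ = tr (a 1 z * (P 1 z * w0 * P 0 z) * a 2 z) := by simp only [mul_assoc]
        _ = 0 := by rw [c0, mul_zero, zero_mul, map_zero]
    have e3 : tr (a 1 z * a 0 z * w2) = 0 := by
      calc tr (a 1 z * a 0 z * w2) = tr ((P 2 z * a 1 z) * (a 0 z * P 0 z) * w2) := by rw [L1, R0]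
        _ = tr (P 2 z * (a 1 z * a 0 z * P 0 z * w2)) := by simp only [mul_assoc]
        _ = tr (a 1 z * a 0 z * (P 0 z * w2 * P 2 z)) := by rw [htr]; simp only [mul_assoc]
        _ = 0 := by rw [c2, mul_zero, map_zero]
    rw [e1, e2, e3, add_zero, add_zero]
  refine (hd.const_smul (2⁻¹ * 2⁻¹ * 2⁻¹ : ℂ)).congr fun z hz => ?_
  have e0 := aeq 0 z hz
  have e1 := aeq 1 z hz
  have e2 := aeq 2 z hz
  simp only [zero_add, show (1 : Fin 3) + 1 = 2 from rfl, show (2 : Fin 3) + 1 = 0 from rfl]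
    at e0 e1 e2
  rw [e0, e1, e2]
  simp only [smul_mul_assoc, mul_smul_comm, smul_smul, map_smul, Pi.smul_apply, mul_assoc]

end Projections

/-! ### The projections onto the lines of a flag -/

section Lines

theorem SU3.mul_conjTranspose_self (U : SU3) : U.1 * (U.1).conjTranspose = 1 :=
  mul_eq_one_comm.1 (SU3.conjTranspose_mul_self U)

theorem exists_proj_eq (z : Flag) : ∃ U : SU3, proj U = z :=
  Quotient.exists_rep z

theorem line_proj (k : Fin 3) (U : SU3) :
    line k (proj U) = U.1 * Matrix.single k k 1 * (U.1).conjTranspose := by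
  ext a b
  change U.1 a k * conj (U.1 b k) = _
  rw [Matrix.mul_apply, Finset.sum_eq_single k]
  · simp [Matrix.mul_apply, Matrix.single_apply]
  · intro c _ hc
    simp [Matrix.mul_apply, Ne.symm hc]
  · simp

theorem conjTranspose_line (k : Fin 3) (z : Flag) : (line k z).conjTranspose = line k z := by
  obtain ⟨U, rfl⟩ := exists_proj_eq z
  simp [line_proj, Matrix.conjTranspose_mul, Matrix.mul_assoc]

/-- The corner of `M` between two of the projections is a multiple of a matrix unit in the frame. -/
theorem line_mul_mul_line (i j : Fin 3) (U : SU3) (M : Matrix (Fin 3) (Fin 3) ℂ) :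
    line i (proj U) * M * line j (proj U) =
      ((U.1).conjTranspose * M * U.1) i j •
        (U.1 * Matrix.single i j 1 * (U.1).conjTranspose) := by
  rw [line_proj, line_proj]
  have h : Matrix.single i i 1 * ((U.1).conjTranspose * M * U.1) * Matrix.single j j 1 =
      ((U.1).conjTranspose * M * U.1) i j • Matrix.single i j (1 : ℂ) := by
    rw [Matrix.single_mul_mul_single]
    simp
  rw [← Matrix.smul_mul, ← Matrix.mul_smul, ← h]
  simp only [Matrix.mul_assoc]

theorem frame_single_mul (i j k : Fin 3) (U : SU3) :
    (U.1 * Matrix.single i j 1 * (U.1).conjTranspose) *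
      (U.1 * Matrix.single j k 1 * (U.1).conjTranspose) =
    U.1 * Matrix.single i k (1 : ℂ) * (U.1).conjTranspose := by
  have h : Matrix.single i j (1 : ℂ) * Matrix.single j k (1 : ℂ) = Matrix.single i k 1 := by simp
  calc _ = U.1 * (Matrix.single i j 1 * ((U.1).conjTranspose * U.1) * Matrix.single j k 1) *
        (U.1).conjTranspose := by simp only [Matrix.mul_assoc]
    _ = _ := by rw [SU3.conjTranspose_mul_self, Matrix.mul_one, h]

theorem line_mul_self (i : Fin 3) (z : Flag) : line i z * line i z = line i z := by
  obtain ⟨U, rfl⟩ := exists_proj_eq z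
  rw [line_proj, frame_single_mul]

theorem line_mul_line_of_ne {i j : Fin 3} (h : i ≠ j) (z : Flag) : line i z * line j z = 0 := by
  obtain ⟨U, rfl⟩ := exists_proj_eq z
  have := line_mul_mul_line i j U 1
  rwa [Matrix.mul_one, Matrix.mul_one, SU3.conjTranspose_mul_self, Matrix.one_apply_ne h,
    zero_smul] at this

theorem sum_line (z : Flag) : ∑ i, line i z = 1 := by
  obtain ⟨U, rfl⟩ := exists_proj_eq z
  simp only [line_proj, ← Matrix.mul_sum, ← Matrix.sum_mul]
  rw [show ∑ i : Fin 3, Matrix.single i i (1 : ℂ) = 1 from Matrix.sum_single_one,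
    Matrix.mul_one, SU3.mul_conjTranspose_self]

/-- The cubic form `η₁ η₂ η₃` in terms of the projections onto the lines of the flag. -/
def cubicTrace (P X : Triple) : ℂ :=
  Matrix.trace ((P 2 * X 1 * P 1) * (P 1 * X 0 * P 0) * (P 0 * X 2 * P 2))

/-- Each corner is a form `ηᵢ` times a matrix unit in the frame. The indices close up along 2 ← 1 ←
0 ← 2, so the product is a multiple of a diagonal unit, of trace 1. The left side involves only the
flag, which proves torus invariance. -/
theorem cubicTrace_line (U : SU3) (X : Triple) :
    cubicTrace (fun k => line k (proj U)) X = eta 0 U X * eta 1 U X * eta 2 U X := by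
  have e0 : eta 0 U X = ((U.1).conjTranspose * X 1 * U.1) 2 1 := rfl
  have e1 : eta 1 U X = ((U.1).conjTranspose * X 2 * U.1) 0 2 := rfl
  have e2 : eta 2 U X = ((U.1).conjTranspose * X 0 * U.1) 1 0 := rfl
  rw [cubicTrace, line_mul_mul_line, line_mul_mul_line, line_mul_mul_line, ← e0, ← e1, ← e2]
  simp only [Matrix.smul_mul, Matrix.mul_smul, smul_smul, frame_single_mul]
  rw [Matrix.trace_smul, Matrix.trace_mul_comm, ← Matrix.mul_assoc, SU3.conjTranspose_mul_self,
    Matrix.one_mul, Matrix.trace_single_eq_same]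
  simp only [smul_eq_mul]
  ring

end Lines

/-! ### Linear algebra of the differential -/

section Differential

variable {S : Type*} [TopologicalSpace S] [ChartedSpace ℂ S]

theorem eta_add (i : Fin 3) (U : SU3) (X Y : Triple) :
    eta i U (X + Y) = eta i U X + eta i U Y := by
  simp [eta, Matrix.mul_add, Matrix.add_mul]

theorem eta_smul (i : Fin 3) (U : SU3) (r : ℝ) (X : Triple) :
    eta i U (r • X) = r * eta i U X := by
  simp [eta]

theorem tangentOf_zero (U : SU3) : tangentOf U 0 = 0 := by
  have h : mcMatrix 0 = 0 := by
    ext a b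
    fin_cases a <;> fin_cases b <;> simp [mcMatrix]
  funext k
  simp [tangentOf, h]

variable {f : S → Flag} {p : S}

theorem flagDeriv_add (v w : TangentSpace 𝓘(ℂ) p) :
    flagDeriv f p (v + w) = flagDeriv f p v + flagDeriv f p w := by
  funext k
  ext a b
  exact (mfderiv 𝓘(ℝ, ℂ) 𝓘(ℝ, ℂ) (fun x => line k (f x) a b) p : ℂ →L[ℝ] ℂ).map_add v w

theorem flagDeriv_smul (r : ℝ) (v : TangentSpace 𝓘(ℂ) p) :
    flagDeriv f p ((r : ℂ) • v) = r • flagDeriv f p v := by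
  funext k
  ext a b
  exact (mfderiv 𝓘(ℝ, ℂ) 𝓘(ℝ, ℂ) (fun x => line k (f x) a b) p : ℂ →L[ℝ] ℂ).map_smul r v

theorem flagDeriv_zero : flagDeriv f p 0 = 0 := by
  funext k
  ext a b
  exact (mfderiv 𝓘(ℝ, ℂ) 𝓘(ℝ, ℂ) (fun x => line k (f x) a b) p : ℂ →L[ℝ] ℂ).map_zero

theorem gNK_self (U : SU3) (X : Triple) : gNK (proj U) X X = ∑ i, ‖eta i U X‖ ^ 2 := by
  change (∑ i, eta i U X * conj (eta i U X)).re = _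
  rw [Complex.re_sum]
  refine Finset.sum_congr rfl fun i _ => ?_
  rw [Complex.mul_conj, Complex.ofReal_re, Complex.normSq_eq_norm_sq]

namespace IsJHolomorphicCurve

theorem eta_smul (hf : IsJHolomorphicCurve f) {U : SU3} (hU : proj U = f p) (i : Fin 3) (c : ℂ)
    (v : TangentSpace 𝓘(ℂ) p) :
    eta i U (flagDeriv f p (c • v)) = c * eta i U (flagDeriv f p v) := by
  have h : eta i U (flagDeriv f p (Complex.I • v)) = Complex.I * eta i U (flagDeriv f p v) := by
    rw [hf.holomorphic, ← hU, eta_JNK]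
  have hc : c • v = (c.re : ℂ) • v + (c.im : ℂ) • Complex.I • v := by
    rw [smul_smul, ← add_smul, Complex.re_add_im]
  rw [hc, flagDeriv_add, flagDeriv_smul, flagDeriv_smul, eta_add, FlagCubic.eta_smul,
    FlagCubic.eta_smul, h, ← mul_assoc, ← add_mul, Complex.re_add_im]

theorem exists_eta_ne_zero (hf : IsJHolomorphicCurve f) {U : SU3} (hU : proj U = f p)
    {v : TangentSpace 𝓘(ℂ) p} (hv : v ≠ 0) : ∃ i, eta i U (flagDeriv f p v) ≠ 0 := by
  by_contra! h
  -- An arbitrary `Triple` with vanishing `eta` need not be zero, but values of `JNK` are rebuilt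
  -- from their `eta`-components; hence the use of `Complex.I • v` in place of `v`.
  have h0 : flagDeriv f p (Complex.I • v) = flagDeriv f p 0 := by
    rw [hf.holomorphic, ← hU, flagDeriv_zero]
    change tangentOf U (fun i => Complex.I * eta i U (flagDeriv f p v)) = 0
    simp only [h, mul_zero]
    exact tangentOf_zero U
  have h1 := hf.immersion p h0
  exact hv ((smul_eq_zero.1 h1).resolve_left Complex.I_ne_zero)

theorem gNK_pos (hf : IsJHolomorphicCurve f) {v : TangentSpace 𝓘(ℂ) p} (hv : v ≠ 0) :
    0 < gNK (f p) (flagDeriv f p v) (flagDeriv f p v) := by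
  obtain ⟨U, hU⟩ := exists_proj_eq (f p)
  obtain ⟨i, hi⟩ := hf.exists_eta_ne_zero hU hv
  rw [← hU, gNK_self]
  exact Finset.sum_pos' (fun _ _ => by positivity) ⟨i, Finset.mem_univ i, by positivity⟩

theorem gNK_smul (hf : IsJHolomorphicCurve f) (c : ℂ) (v : TangentSpace 𝓘(ℂ) p) :
    gNK (f p) (flagDeriv f p (c • v)) (flagDeriv f p (c • v)) =
      ‖c‖ ^ 2 * gNK (f p) (flagDeriv f p v) (flagDeriv f p v) := by
  obtain ⟨U, hU⟩ := exists_proj_eq (f p)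
  rw [← hU, gNK_self, gNK_self, Finset.mul_sum]
  refine Finset.sum_congr rfl fun i _ => ?_
  rw [hf.eta_smul hU, norm_mul, mul_pow]

end IsJHolomorphicCurve

/-- The coordinate vector at `p` of the preferred chart at `p`. -/
def coordVector (p : S) : TangentSpace 𝓘(ℂ) p := (1 : ℂ)

/-- The coordinate covector at `p` of the preferred chart at `p`. -/
def coordCovector (p : S) : TangentSpace 𝓘(ℂ) p →L[ℂ] ℂ := ContinuousLinearMap.id ℂ ℂ

theorem coordVector_ne_zero (p : S) : coordVector p ≠ 0 := one_ne_zero (α := ℂ)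

theorem coordCovector_smul_coordVector (v : TangentSpace 𝓘(ℂ) p) :
    coordCovector p v • coordVector p = v := mul_one (M := ℂ) v

theorem clm_eq_smul_coordCovector (σ : TangentSpace 𝓘(ℂ) p →L[ℂ] ℂ) :
    σ = σ (coordVector p) • coordCovector p := by
  refine ContinuousLinearMap.ext fun v => ?_
  conv_lhs => rw [← coordCovector_smul_coordVector v]
  rw [map_smul, smul_apply, smul_eq_mul, smul_eq_mul, mul_comm]

theorem FramePoint.σ_coordVector_ne_zero (hf : IsJHolomorphicCurve f) (q : FramePoint f) :
    q.σ (coordVector q.pt) ≠ 0 := by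
  intro h
  have := q.unitary (coordVector q.pt)
  rw [h, norm_zero] at this
  have := hf.gNK_pos (coordVector_ne_zero q.pt)
  nlinarith

theorem IsJHolomorphicCurve.exists_framePoint (hf : IsJHolomorphicCurve f) (p : S) :
    ∃ q : FramePoint f, q.pt = p := by
  obtain ⟨U, hU⟩ := exists_proj_eq (f p)
  set r := gNK (f p) (flagDeriv f p (coordVector p)) (flagDeriv f p (coordVector p)) with hr
  have h0 : 0 ≤ r := (hf.gNK_pos (coordVector_ne_zero p)).le
  -- The factor `√r` makes the coframe unitary on `coordVector p`, hence on every vector by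
  -- homogeneity.
  refine ⟨⟨p, ((Real.sqrt r : ℝ) : ℂ) • coordCovector p, fun v => ?_, U, hU⟩, rfl⟩
  conv_rhs => rw [← coordCovector_smul_coordVector v]
  rw [hf.gNK_smul, ← hr, smul_apply, norm_smul, mul_pow, Complex.norm_real, Real.norm_eq_abs,
    sq_abs, Real.sq_sqrt h0, mul_comm]

theorem IsJHolomorphicCurve.isCoefficients_iff (hf : IsJHolomorphicCurve f)
    (A : Fin 3 → FramePoint f → ℂ) : IsCoefficients f A ↔ ∀ i q,
      A i q = eta i q.frame (flagDeriv f q.pt (coordVector q.pt)) / q.σ (coordVector q.pt) := by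
  refine forall_congr' fun i => forall_congr' fun q => ⟨fun h => ?_, fun h v => ?_⟩
  · rw [eq_div_iff (q.σ_coordVector_ne_zero hf), h]
  · rw [← coordCovector_smul_coordVector v, hf.eta_smul q.adapted, map_smul, smul_eq_mul, h]
    field_simp [q.σ_coordVector_ne_zero hf]

theorem IsJHolomorphicCurve.existsUnique_isCoefficients (hf : IsJHolomorphicCurve f) :
    ∃! A : Fin 3 → FramePoint f → ℂ, IsCoefficients f A := by
  refine ⟨fun i q => eta i q.frame (flagDeriv f q.pt (coordVector q.pt)) / q.σ (coordVector q.pt),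
    (hf.isCoefficients_iff _).2 fun _ _ => rfl, fun A hA => ?_⟩
  funext i q
  exact (hf.isCoefficients_iff A).1 hA i q

/-- The coefficient of the cubic form in the coordinate of the preferred chart at `p`. -/
def cubicCoeff (f : S → Flag) (p : S) : ℂ :=
  cubicTrace (fun k => line k (f p)) (flagDeriv f p (coordVector p))

theorem cubicTrace_flagDeriv_smul (hf : IsJHolomorphicCurve f) (c : ℂ) (v : TangentSpace 𝓘(ℂ) p) :
    cubicTrace (fun k => line k (f p)) (flagDeriv f p (c • v)) =
      c ^ 3 * cubicTrace (fun k => line k (f p)) (flagDeriv f p v) := by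
  obtain ⟨U, hU⟩ := exists_proj_eq (f p)
  have h := hf.eta_smul hU
  simp only [← hU, cubicTrace_line, h]
  ring

theorem cubicTrace_flagDeriv (hf : IsJHolomorphicCurve f) (v : TangentSpace 𝓘(ℂ) p) :
    cubicTrace (fun k => line k (f p)) (flagDeriv f p v) =
      coordCovector p v ^ 3 * cubicCoeff f p := by
  rw [cubicCoeff, ← cubicTrace_flagDeriv_smul hf, coordCovector_smul_coordVector]

/-- The descent: the right-hand side depends on `q` only through its base point. -/
theorem IsCoefficients.smul_cube {A : Fin 3 → FramePoint f → ℂ}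
    (hA : IsCoefficients f A) (q : FramePoint f) :
    (A 0 q * A 1 q * A 2 q) • cube q.σ = cubicCoeff f q.pt • cube (coordCovector q.pt) := by
  have h : cubicCoeff f q.pt = A 0 q * A 1 q * A 2 q * q.σ (coordVector q.pt) ^ 3 := by
    rw [cubicCoeff, ← q.adapted, cubicTrace_line, hA, hA, hA]
    ring
  have hc : cube q.σ = q.σ (coordVector q.pt) ^ 3 • cube (coordCovector q.pt) := by
    refine ContinuousLinearMap.ext fun u => ContinuousLinearMap.ext fun v =>
      ContinuousLinearMap.ext fun w => ?_
    have h1 : ∀ v, q.σ v = q.σ (coordVector q.pt) * coordCovector q.pt v := fun v =>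
      congrArg (fun σ => σ v) (clm_eq_smul_coordCovector q.σ)
    simp only [smul_apply, smul_eq_mul, cube_apply]
    rw [h1 u, h1 v, h1 w]
    ring
  rw [h, hc, smul_smul]

end Differential

/-! ### The cubic form in a chart -/

section Trivialization

open Bundle

/-- Peels one argument off a bundle of homomorphisms; it is iterated for trilinear forms. -/
theorem continuousLinearMapAt_hom_apply {𝕜 B F₁ F₂ : Type*} {E₁ E₂ : B → Type*}
    [NontriviallyNormedField 𝕜] [TopologicalSpace B]
    [∀ x, AddCommGroup (E₁ x)] [∀ x, Module 𝕜 (E₁ x)] [NormedAddCommGroup F₁] [NormedSpace 𝕜 F₁]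
    [TopologicalSpace (TotalSpace F₁ E₁)] [∀ x, TopologicalSpace (E₁ x)]
    [∀ x, AddCommGroup (E₂ x)] [∀ x, Module 𝕜 (E₂ x)] [NormedAddCommGroup F₂] [NormedSpace 𝕜 F₂]
    [TopologicalSpace (TotalSpace F₂ E₂)] [∀ x, TopologicalSpace (E₂ x)]
    [FiberBundle F₁ E₁] [VectorBundle 𝕜 F₁ E₁] [FiberBundle F₂ E₂] [VectorBundle 𝕜 F₂ E₂]
    [∀ x, IsTopologicalAddGroup (E₂ x)] [∀ x, ContinuousSMul 𝕜 (E₂ x)] {x₀ x : B}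
    (h₁ : x ∈ (trivializationAt F₁ E₁ x₀).baseSet) (h₂ : x ∈ (trivializationAt F₂ E₂ x₀).baseSet)
    (φ : E₁ x →L[𝕜] E₂ x) (v : F₁) :
    (trivializationAt (F₁ →L[𝕜] F₂) (fun x => E₁ x →L[𝕜] E₂ x) x₀).continuousLinearMapAt 𝕜 x φ v =
      (trivializationAt F₂ E₂ x₀).continuousLinearMapAt 𝕜 x
        (φ ((trivializationAt F₁ E₁ x₀).symmL 𝕜 x v)) := by
  rw [Trivialization.continuousLinearMapAt_apply, Trivialization.coe_linearMapAt_of_mem _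
    (by rw [hom_trivializationAt_baseSet]; exact ⟨h₁, h₂⟩)]
  rfl

variable {S : Type*} [TopologicalSpace S] [ChartedSpace ℂ S] [IsManifold 𝓘(ℂ) ω S]

theorem trivializationAt_cubicForm_apply {p₀ p : S} (hp : p ∈ (chartAt ℂ p₀).source)
    (C : CubicForm p) (u v w : ℂ) :
    (trivializationAt (ℂ →L[ℂ] ℂ →L[ℂ] ℂ →L[ℂ] ℂ) (fun p : S => CubicForm p) p₀ ⟨p, C⟩).2 u v w =
      C (tangentCoordChange 𝓘(ℂ) p₀ p p u) (tangentCoordChange 𝓘(ℂ) p₀ p p v)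
        (tangentCoordChange 𝓘(ℂ) p₀ p p w) := by
  have h1 : p ∈ (trivializationAt ℂ (TangentSpace 𝓘(ℂ) : S → Type _) p₀).baseSet := hp
  have h0 : p ∈ (trivializationAt ℂ (Bundle.Trivial S ℂ) p₀).baseSet := Set.mem_univ p
  have hs : ∀ v, (trivializationAt ℂ (TangentSpace 𝓘(ℂ) : S → Type _) p₀).symmL ℂ p v =
      tangentCoordChange 𝓘(ℂ) p₀ p p v := fun v => by
    rw [TangentBundle.symmL_trivializationAt_eq_core hp]
    rfl
  have h2 : p ∈ (trivializationAt (ℂ →L[ℂ] ℂ) (fun p : S => TangentSpace 𝓘(ℂ) p →L[ℂ]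
      Bundle.Trivial S ℂ p) p₀).baseSet := ⟨h1, h0⟩
  rw [← hs, ← hs, ← hs]
  rw [hom_trivializationAt_apply]
  change (trivializationAt (ℂ →L[ℂ] ℂ →L[ℂ] ℂ) (fun p : S => TangentSpace 𝓘(ℂ) p →L[ℂ]
    TangentSpace 𝓘(ℂ) p →L[ℂ] Bundle.Trivial S ℂ p) p₀).continuousLinearMapAt ℂ p
      (C ((trivializationAt ℂ (TangentSpace 𝓘(ℂ) : S → Type _) p₀).symmL ℂ p u)) v w = _
  rw [continuousLinearMapAt_hom_apply h1 h2, continuousLinearMapAt_hom_apply h1 h0]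
  simp

end Trivialization

/-! ### Derivatives of functions on the surface in a fixed chart. -/

section Chart

variable {S : Type*} [TopologicalSpace S] [ChartedSpace ℂ S] [IsManifold 𝓘(ℂ) ω S]

theorem isManifold_real (S : Type*) [TopologicalSpace S] [ChartedSpace ℂ S]
    [IsManifold 𝓘(ℂ) ω S] : IsManifold 𝓘(ℝ, ℂ) ∞ S := by
  refine isManifold_of_contDiffOn _ _ _ fun e e' he he' => ?_
  have h := (contDiffGroupoid ω 𝓘(ℂ)).compatible he he'
  have h1 := ((contDiffGroupoid ω 𝓘(ℂ)).mem_iff_of_eqOnSource (Setoid.refl _)).1 h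
  rw [contDiffGroupoid, mem_groupoid_of_pregroupoid] at h1
  have h2 : ContDiffOn ℂ ω _ _ := h1.1
  exact (h2.restrict_scalars ℝ).of_le le_top

/-- `mfderiv` at `p` is expressed in the preferred chart at `p`; the chain rule with the transition
map from the chart at `p₀` supplies the coordinate change. -/
theorem hasFDerivAt_comp_chart_symm {g : S → ℂ} {p₀ p : S} (hp : p ∈ (chartAt ℂ p₀).source)
    (hg : MDifferentiableAt 𝓘(ℝ, ℂ) 𝓘(ℝ, ℂ) g p) :
    HasFDerivAt (g ∘ (chartAt ℂ p₀).symm)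
      ((mfderiv 𝓘(ℝ, ℂ) 𝓘(ℝ, ℂ) g p : ℂ →L[ℝ] ℂ).comp
        ((tangentCoordChange 𝓘(ℂ) p₀ p p).restrictScalars ℝ)) (chartAt ℂ p₀ p) := by
  have h1 := (hasFDerivWithinAt_tangentCoordChange (I := 𝓘(ℂ)) (x := p₀) (y := p) (z := p)
    ⟨by simpa using hp, by simp⟩)
  have h2 : HasFDerivAt (chartAt ℂ p ∘ (chartAt ℂ p₀).symm) (tangentCoordChange 𝓘(ℂ) p₀ p p)
      (chartAt ℂ p₀ p) := by
    simpa [hasFDerivWithinAt_univ] using h1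
  have h3 : HasFDerivAt (g ∘ (chartAt ℂ p).symm) (mfderiv 𝓘(ℝ, ℂ) 𝓘(ℝ, ℂ) g p : ℂ →L[ℝ] ℂ)
      ((chartAt ℂ p ∘ (chartAt ℂ p₀).symm) (chartAt ℂ p₀ p)) := by
    have := hg.hasMFDerivAt.2
    simp only [Function.comp_apply, (chartAt ℂ p₀).left_inv hp]
    simp only [writtenInExtChartAt, mfld_simps] at this
    exact hasFDerivWithinAt_univ.1 this
  refine (h3.comp _ (h2.restrictScalars ℝ)).congr_of_eventuallyEq ?_
  have ht : (chartAt ℂ p₀) p ∈ (chartAt ℂ p₀).target := (chartAt ℂ p₀).map_source hp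
  have hc : ContinuousAt (chartAt ℂ p₀).symm (chartAt ℂ p₀ p) := (chartAt ℂ p₀).continuousAt_symm ht
  have hm : (chartAt ℂ p).source ∈ nhds ((chartAt ℂ p₀).symm (chartAt ℂ p₀ p)) := by
    rw [(chartAt ℂ p₀).left_inv hp]
    exact (chartAt ℂ p).open_source.mem_nhds (mem_chart_source ℂ p)
  filter_upwards [hc hm] with z hz
  simp only [Function.comp_apply]
  rw [(chartAt ℂ p).left_inv hz]

end Chart

/-! ### Entrywise calculus for matrix-valued functions. -/

section MatrixFunctions

variable {E F : Type*} [NormedAddCommGroup E] [NormedSpace ℝ E] [NormedAddCommGroup F]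
  [NormedSpace ℂ F] {n : Type*} [Fintype n] [DecidableEq n]

/-- Writes `L` as a finite combination of entries, so that entrywise regularity suffices and no norm
on matrices is chosen. -/
theorem linearMap_matrix_apply (L : Matrix n n ℂ →ₗ[ℂ] F) (M : Matrix n n ℂ) :
    L M = ∑ a, ∑ b, M a b • L (Matrix.single a b 1) := by
  conv_lhs => rw [Matrix.matrix_eq_sum_single M]
  simp only [map_sum]
  refine Finset.sum_congr rfl fun a _ => Finset.sum_congr rfl fun b _ => ?_
  rw [← map_smul, Matrix.smul_single, smul_eq_mul, mul_one]

theorem fderiv_linearMap_matrix (L : Matrix n n ℂ →ₗ[ℂ] F) {G : E → Matrix n n ℂ} {z : E}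
    {D : n → n → E →L[ℝ] ℂ} (h : ∀ a b, HasFDerivAt (fun w => G w a b) (D a b) z) (v : E) :
    fderiv ℝ (fun w => L (G w)) z v = L (Matrix.of fun a b => D a b v) := by
  have h1 : HasFDerivAt (fun w => L (G w))
      (∑ a, ∑ b, (D a b).smulRight (L (Matrix.single a b 1))) z := by
    simp_rw [linearMap_matrix_apply L (G _)]
    exact HasFDerivAt.fun_sum fun a _ => HasFDerivAt.fun_sum fun b _ => (h a b).smul_const _
  rw [h1.fderiv, linearMap_matrix_apply L]
  simp

theorem contDiffOn_linearMap_matrix (L : Matrix n n ℂ →ₗ[ℂ] F) {G : E → Matrix n n ℂ} {U : Set E}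
    {m : WithTop ℕ∞} (h : ∀ a b, ContDiffOn ℝ m (fun w => G w a b) U) :
    ContDiffOn ℝ m (fun w => L (G w)) U := by
  simp_rw [linearMap_matrix_apply L (G _)]
  exact ContDiffOn.sum fun a _ => ContDiffOn.sum fun b _ => (h a b).smul contDiffOn_const

/-- `differentiableOn_trace_corners` for matrices, with entrywise derivatives; `Φ` is any normed
algebra structure on the matrix algebra. -/
theorem differentiableOn_cubicTrace {A : Type*} [NormedRing A] [NormedAlgebra ℂ A]
    (Φ : Matrix (Fin 3) (Fin 3) ℂ ≃ₐ[ℂ] A) {U : Set ℂ} (hU : IsOpen U) {P : ℂ → Triple}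
    {X : ℂ → ℂ → Triple} {D : ℂ → Fin 3 → Fin 3 → Fin 3 → ℂ →L[ℝ] ℂ}
    (sP : ∀ k a b, ContDiffOn ℝ ∞ (fun z => P z k a b) U)
    (hD : ∀ z ∈ U, ∀ k a b, HasFDerivAt (fun w => P w k a b) (D z k a b) z)
    (hX : ∀ z ∈ U, ∀ v k a b, X z v k a b = D z k a b v)
    (hP : ∀ z k, P z k * P z k = P z k) (hPP : ∀ z i j, i ≠ j → P z i * P z j = 0)
    (hsum : ∀ z, ∑ k, P z k = 1)
    (hq : ∀ z ∈ U, ∀ i, P z (i + 1) * X z Complex.I i * P z i =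
      Complex.I • (P z (i + 1) * X z 1 i * P z i))
    (hp : ∀ z ∈ U, ∀ i, P z i * X z Complex.I i * P z (i + 1) =
      -Complex.I • (P z i * X z 1 i * P z (i + 1))) :
    DifferentiableOn ℂ (fun z => cubicTrace (P z) (X z 1)) U := by
  have : FiniteDimensional ℂ A := Φ.toLinearEquiv.finiteDimensional
  have dP : ∀ z ∈ U, ∀ k v, fderiv ℝ (fun w => Φ (P w k)) z v = Φ (X z v k) := fun z hz k v => by
    have h := fderiv_linearMap_matrix Φ.toLinearMap (hD z hz k) v
    have e : (Matrix.of fun a b => D z k a b v) = X z v k := by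
      ext a b
      exact (hX z hz v k a b).symm
    rw [e] at h
    exact h
  let tr : A →L[ℂ] ℂ := LinearMap.toContinuousLinearMap
    ((Matrix.traceLinearMap (Fin 3) ℂ ℂ).comp Φ.symm.toLinearMap)
  have htr : ∀ M, tr (Φ M) = Matrix.trace M := fun M =>
    congrArg Matrix.trace (Φ.symm_apply_apply M)
  refine (differentiableOn_trace_corners hU (P := fun k z => Φ (P z k))
    (fun k => contDiffOn_linearMap_matrix Φ.toLinearMap (sP k)) (fun z _ i => ?_)
    (fun z _ i j hij => ?_) (fun z _ => ?_) (fun z hz i => ?_) (fun z hz i => ?_) tr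
    (fun x y => ?_)).congr fun z hz => ?_
  · rw [← map_mul, hP]
  · rw [← map_mul, hPP z i j hij, map_zero]
  · rw [← map_sum, hsum, map_one]
  · simp only [dP z hz, ← map_mul, ← map_smul, hq z hz]
  · simp only [dP z hz, ← map_mul, ← map_smul, hp z hz]
  · obtain ⟨x, rfl⟩ := Φ.surjective x
    obtain ⟨y, rfl⟩ := Φ.surjective y
    rw [← map_mul, ← map_mul, htr, htr, Matrix.trace_mul_comm]
  · simp only [dP z hz, ← map_mul, htr]
    rfl

end MatrixFunctions

/-! ### Holomorphy of the cubic form on the surface. -/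

section Holomorphic

variable {S : Type*} [TopologicalSpace S] [ChartedSpace ℂ S] {f : S → Flag}

theorem conjTranspose_flagDeriv (hf : IsJHolomorphicCurve f) {p : S} (k : Fin 3)
    (v : TangentSpace 𝓘(ℂ) p) : (flagDeriv f p v k).conjTranspose = flagDeriv f p v k := by
  ext a b
  have hd : MDifferentiableAt 𝓘(ℝ, ℂ) 𝓘(ℝ, ℂ) (fun x => line k (f x) b a) p :=
    (hf.smooth k b a p).mdifferentiableAt (by simp)
  have h : HasMFDerivAt 𝓘(ℝ, ℂ) 𝓘(ℝ, ℂ) (fun x => line k (f x) a b) p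
      ((Complex.conjCLE : ℂ →L[ℝ] ℂ).comp
        (mfderiv 𝓘(ℝ, ℂ) 𝓘(ℝ, ℂ) (fun x => line k (f x) b a) p : ℂ →L[ℝ] ℂ)) := by
    have e : (fun x => line k (f x) a b) = Complex.conjCLE ∘ fun x => line k (f x) b a := by
      funext x
      exact (congrFun (congrFun (conjTranspose_line k (f x)) a) b).symm
    rw [e]
    exact ((Complex.conjCLE : ℂ →L[ℝ] ℂ).hasMFDerivAt).comp p hd.hasMFDerivAt
  exact (congrArg (fun D : ℂ →L[ℝ] ℂ => D v) h.mfderiv).symm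

/-- In an adapted frame this corner is `eta (i + 2)`, because `i + 2 + 1 = i` and `i + 2 + 2 = i +
1` in `Fin 3`; that form is complex linear along the curve. -/
theorem line_mul_flagDeriv_I_smul (hf : IsJHolomorphicCurve f) {p : S} (i : Fin 3)
    (v : TangentSpace 𝓘(ℂ) p) :
    line (i + 1) (f p) * flagDeriv f p (Complex.I • v) i * line i (f p) =
      Complex.I • (line (i + 1) (f p) * flagDeriv f p v i * line i (f p)) := by
  obtain ⟨U, hU⟩ := exists_proj_eq (f p)
  have h := hf.eta_smul hU (i + 2) Complex.I v
  have h1 : i + 2 + 1 = i ∧ i + 2 + 2 = i + 1 := by clear h; revert i; decide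
  unfold eta at h
  rw [h1.1, h1.2] at h
  rw [← hU, line_mul_mul_line, line_mul_mul_line, h, mul_smul]

/-- The adjoint of the previous identity; conjugation turns `I` into `-I`. -/
theorem line_mul_flagDeriv_I_smul' (hf : IsJHolomorphicCurve f) {p : S} (i : Fin 3)
    (v : TangentSpace 𝓘(ℂ) p) :
    line i (f p) * flagDeriv f p (Complex.I • v) i * line (i + 1) (f p) =
      -Complex.I • (line i (f p) * flagDeriv f p v i * line (i + 1) (f p)) := by
  have h := congrArg Matrix.conjTranspose (line_mul_flagDeriv_I_smul hf i v)
  simpa [Matrix.conjTranspose_mul, conjTranspose_line, conjTranspose_flagDeriv hf,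
    Matrix.mul_assoc] using h

variable [IsManifold 𝓘(ℂ) ω S]

/-- The coefficient of the cubic form is holomorphic in every chart. -/
theorem exists_differentiableOn_cubicCoeff (hf : IsJHolomorphicCurve f) (p₀ : S) :
    ∃ g : ℂ → ℂ, DifferentiableOn ℂ g (chartAt ℂ p₀).target ∧ ∀ p ∈ (chartAt ℂ p₀).source,
      g (chartAt ℂ p₀ p) = (tangentCoordChange 𝓘(ℂ) p₀ p p 1) ^ 3 * cubicCoeff f p := by
  have := isManifold_real S
  set e := chartAt ℂ p₀
  have hd : ∀ p ∈ e.source, ∀ k a b, HasFDerivAt (fun z => line k (f (e.symm z)) a b) _ (e p) :=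
    fun p hp k a b => hasFDerivAt_comp_chart_symm hp
      ((hf.smooth k a b p).mdifferentiableAt (by simp))
  -- The preferred chart at `e.symm z` may jump with `z`; the coordinate change refers every vector
  -- to the one chart at `p₀`.
  let X : ℂ → ℂ → Triple := fun z v =>
    flagDeriv f (e.symm z) (tangentCoordChange 𝓘(ℂ) p₀ (e.symm z) (e.symm z) v)
  have hI : ∀ p, tangentCoordChange 𝓘(ℂ) p₀ p p Complex.I =
      Complex.I • tangentCoordChange 𝓘(ℂ) p₀ p p 1 := fun p => by
    rw [← map_smul, smul_eq_mul, mul_one]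
  refine ⟨_, differentiableOn_cubicTrace Matrix.toEuclideanCLM.toAlgEquiv e.open_target
    (P := fun z k => line k (f (e.symm z))) (X := X)
    (fun k a b => contMDiffOn_iff_contDiffOn.1
      ((hf.smooth k a b).comp_contMDiffOn contMDiffOn_chart_symm))
    (fun z hz k a b => by simpa only [e.right_inv hz] using hd _ (e.map_target hz) k a b)
    (fun z hz v k a b => rfl) (fun z k => line_mul_self k _)
    (fun z i j hij => line_mul_line_of_ne hij _) (fun z => sum_line _) (fun z hz i => ?_)
    (fun z hz i => ?_), fun p hp => ?_⟩
  · simp only [X, hI]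
    exact line_mul_flagDeriv_I_smul hf i _
  · simp only [X, hI]
    exact line_mul_flagDeriv_I_smul' hf i _
  -- Tangent spaces depend on the point, so `e.symm (e p)` is generalized before being identified
  -- with `p`.
  · have h : ∀ p', p' = p → cubicTrace (fun k => line k (f p'))
        (flagDeriv f p' (tangentCoordChange 𝓘(ℂ) p₀ p' p' 1)) =
          (tangentCoordChange 𝓘(ℂ) p₀ p p 1) ^ 3 * cubicCoeff f p := by
      rintro _ rfl
      exact cubicTrace_flagDeriv hf _
    exact h _ (e.left_inv hp)

/-- The cubic form `η₁ η₂ η₃` of a `J_NK`-holomorphic curve. -/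
def cubicSection (hf : IsJHolomorphicCurve f) : HolomorphicCubicForm S where
  toFun p := cubicCoeff f p • cube (coordCovector p)
  contMDiff_toFun := by
    intro p₀
    rw [Bundle.contMDiffAt_section]
    obtain ⟨g, hg, hgc⟩ := exists_differentiableOn_cubicCoeff hf p₀
    have hm := mem_chart_source ℂ p₀
    have ht := (chartAt ℂ p₀).open_target.mem_nhds ((chartAt ℂ p₀).map_source hm)
    have ha : ContDiffAt ℂ ω g (chartAt ℂ p₀ p₀) := (hg.analyticAt ht).contDiffAt
    have hs : ContMDiffAt 𝓘(ℂ) 𝓘(ℂ) ω (fun p => g (chartAt ℂ p₀ p)) p₀ :=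
      (contMDiffAt_iff_contDiffAt.2 ha).comp p₀
        (contMDiffOn_chart.contMDiffAt ((chartAt ℂ p₀).open_source.mem_nhds hm))
    -- `B` is `dz³` for the chart at `p₀`. The section is `g • B` there, its three arguments
    -- contributing the cube of the coordinate change.
    let B : ℂ →L[ℂ] ℂ →L[ℂ] ℂ →L[ℂ] ℂ :=
      (ContinuousLinearMap.id ℂ ℂ).smulRight
        ((ContinuousLinearMap.id ℂ ℂ).smulRight (ContinuousLinearMap.id ℂ ℂ))
    refine (hs.smul (contMDiffAt_const (c := B))).congr_of_eventuallyEq ?_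
    filter_upwards [(chartAt ℂ p₀).open_source.mem_nhds hm] with p hp
    refine ContinuousLinearMap.ext fun u => ContinuousLinearMap.ext fun v =>
      ContinuousLinearMap.ext fun w => ?_
    rw [trivializationAt_cubicForm_apply hp]
    change _ = (g (chartAt ℂ p₀ p) • B) u v w
    rw [hgc p hp]
    have hc : ∀ v : ℂ, coordCovector p (tangentCoordChange 𝓘(ℂ) p₀ p p v) =
        v * tangentCoordChange 𝓘(ℂ) p₀ p p 1 := fun v => by
      rw [← smul_eq_mul v, ← map_smul, smul_eq_mul, mul_one]
      rfl
    have hl : ∀ a b c : TangentSpace 𝓘(ℂ) p, (cubicCoeff f p • cube (coordCovector p)) a b c =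
        cubicCoeff f p * (coordCovector p a * (coordCovector p b * coordCovector p c)) :=
      fun _ _ _ => rfl
    refine (hl _ _ _).trans ?_
    rw [hc, hc, hc]
    simp only [B, ContinuousLinearMap.smulRight_apply, ContinuousLinearMap.id_apply, smul_apply,
      smul_eq_mul]
    ring

end Holomorphic

end FlagCubic

end

/-- For a `J_NK`-holomorphic curve `f : S → SU(3)/T²` there are unique functions `A₁, A₂, A₃` on
`𝓕(S)` with `ηᵢ = Aᵢ σ`, and `A₁ A₂ A₃ σ³` descends to a (unique) holomorphic section of
`Sym³(T^*S)`. -/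
theorem proposition5p2 {S : Type*} [TopologicalSpace S] [ChartedSpace ℂ S]
    [IsManifold 𝓘(ℂ) ω S] (f : S → FlagCubic.Flag) (hf : FlagCubic.IsJHolomorphicCurve f) :
    (∃! A : Fin 3 → FlagCubic.FramePoint f → ℂ, FlagCubic.IsCoefficients f A) ∧
    ∀ A : Fin 3 → FlagCubic.FramePoint f → ℂ, FlagCubic.IsCoefficients f A →
      ∃! C : FlagCubic.HolomorphicCubicForm S, ∀ q : FlagCubic.FramePoint f,
        C q.pt = (A 0 q * A 1 q * A 2 q) • FlagCubic.cube q.σ := by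
  refine ⟨hf.existsUnique_isCoefficients, fun A hA =>
    ⟨FlagCubic.cubicSection hf, fun q => (hA.smul_cube q).symm, fun C hC => ?_⟩⟩
  refine ContMDiffSection.ext fun p => ?_
  -- Uniqueness needs a unitary coframe and an adapted frame over every point.
  obtain ⟨q, rfl⟩ := hf.exists_framePoint p
  exact (hC q).trans (hA.smul_cube q)
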